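/- Let $D\ge 0$ be an integer and $n=2D+1$. The folded $n$-cube $\square_n$ is the graph whose vertices are the unordered pairs $\{u,u'\}$ of complementary subsets of $\{1,\dots,n\}$, two distinct vertices $\{z_1,z_2\}$, $\{w_1,w_2\}$ being adjacent when $\min_{i,j}|z_i\,\triangle\, w_j|=1$. Let $0\le d\le 2D+1$ be an integer, and let $A(\square_n,d)$ be the maximum size of a nonempty set $C$ of vertices any two distinct elements of which are at path-length distance at least $d$. Put $\mathcal I'=\{(i,j,t)\in\mathbb Z^3: 0\le t\le i,j\le D,\ i+j-t\le 2D\}$. With the convention $\binom{m}{k}=0$ unless $0\le k\le m$, let, for $0\le r\le i,j\le D$ and $(i,j,t)\in\mathcal I'$, $$\beta^r_{i,j,t}=\binom{2D+1-2r}{i-r}\sum_{l=0}^{D}(-1)^{r-l}\binom{r}{l}\binom{i-l}{t-l}\binom{2D+1+l-i-r}{j-t-r+l},$$ and let $\nu=\nu(i,j,t)=\min\{i+j-2t,\ 2D+1-(i+j-2t)\}$. Consider the semidefinite program in real variables $x^t_{i,j}$, $(i,j,t)\in\mathcal I'$: $$\text{maximize}\quad \sum_{i=0}^{D}\binom{2D+1}{i}x^0_{i,0}$$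 subject to the following conditions, for all $(i,j,t),(i',j',t')\in\mathcal I'$: (i) $x^0_{0,0}=1$; (ii) $0\le x^t_{i,j}\le x^0_{i,0}$; (iii) if $0\le i+j-2t\le D$ and $(i',j',i'+j'-2t')$ is a permutation of $(i,j,i+j-2t)$, then $x^t_{i,j}=x^{t'}_{i',j'}$; (iv) if $D+1\le i+j-2t\le 2D$ and $(i',j',2D+1-(i'+j'-2t'))$ is a permutation of $(i,j,2D+1-(i+j-2t))$, then $x^t_{i,j}=x^{t'}_{i',j'}$; (v) $x^t_{i,j}=0$ if $\{i,j,i+j-2t,2D+1-(i+j-2t)\}\cap\{1,2,\dots,d-1\}\ne\emptyset$; (vi) for each $r=0,1,\dots,D$ the matrices $$\Bigl(\sum_t\beta^r_{i,j,t}\,x^t_{i,j}\Bigr)_{i,j=r}^{D}\quad\text{and}\quad\Bigl(\sum_t\beta^r_{i,j,t}\,(x^0_{\nu,0}-x^t_{i,j})\Bigr)_{i,j=r}^{D}$$ are positive semidefinite, the sums being over all $t$ with $(i,j,t)\in\mathcal I'$. Then the maximum in this program is attained, and it is an upper bound on $A(\square_{2D+1},d)$. -/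

import Mathlib

open scoped symmDiff

namespace FoldedCubeSDP

/-! ## The folded cube and its codes -/

/-- The vertices of the folded `n`-cube: unordered pairs `{u, u'}` of complementary subsets of
an `n`-element set. -/
abbrev Vertex (n : ℕ) : Type :=
  {z : Sym2 (Finset (Fin n)) //
    ∃ u u' : Finset (Fin n), u ∩ u' = ∅ ∧ u ∪ u' = Finset.univ ∧ z = s(u, u')}

noncomputable instance (n : ℕ) : Fintype (Vertex n) := Fintype.ofFinite _

/-- The folded `n`-cube: distinct vertices `z = {z₁, z₂}` and `w = {w₁, w₂}` are adjacent when
some `z_i ∆ w_j` is a singleton. For `z ≠ w` no `z_i ∆ w_j` is empty, so that this says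
`min |z_i ∆ w_j| = 1`. -/
def foldedCube (n : ℕ) : SimpleGraph (Vertex n) where
  Adj z w := z ≠ w ∧ ∃ u ∈ z.1, ∃ v ∈ w.1, (u ∆ v).card = 1
  symm := ⟨by
    rintro z w ⟨hne, u, hu, v, hv, h⟩
    exact ⟨hne.symm, v, hv, u, hu, by rwa [symmDiff_comm]⟩⟩
  loopless := ⟨fun _ h => h.1 rfl⟩

/-- A code (nonempty set of vertices) in which distinct elements have path-length distance at
least `d`. -/
def IsCode {V : Type*} (G : SimpleGraph V) (d : ℕ) (C : Finset V) : Prop :=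
  C.Nonempty ∧ ∀ x ∈ C, ∀ y ∈ C, x ≠ y → d ≤ G.dist x y

open scoped Classical in
/-- `A(G, d)`: the maximum size of a code in `G` with minimum distance at least `d`. -/
noncomputable def maxCodeSize {V : Type*} [Fintype V] (G : SimpleGraph V) (d : ℕ) : ℕ :=
  (Finset.univ.filter fun C : Finset V => IsCode G d C).sup Finset.card

/-! ## The semidefinite program -/

/-- Binomial coefficient of integers, zero unless `0 ≤ k ≤ n`. -/
def binom (n k : ℤ) : ℤ :=
  if 0 ≤ k ∧ k ≤ n then (n.toNat.choose k.toNat : ℤ) else 0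

/-- The coefficients `β^r_{i,j,t}` for the folded `(2D+1)`-cube. All differences are taken in `ℤ`,
and the sign `(-1)^(r+l)` is `(-1)^(r-l)`. -/
def beta (D r i j t : ℕ) : ℤ :=
  binom (2 * D + 1 - 2 * r) (i - r) *
    ∑ l ∈ Finset.range (D + 1),
      (-1) ^ (r + l) * binom r l * binom (i - l) (t - l) *
        binom (2 * D + 1 + l - i - r) (j - t - r + l)

/-- The index set of the variables: `0 ≤ t ≤ i, j ≤ D` and `i + j - t ≤ 2D`. -/
def IsIndex (D i j t : ℕ) : Prop :=
  t ≤ i ∧ t ≤ j ∧ i ≤ D ∧ j ≤ D ∧ i + j - t ≤ 2 * D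

/-- `ν = min {i+j-2t, 2D+1-(i+j-2t)}`. -/
def nu (D i j t : ℕ) : ℕ :=
  min (i + j - 2 * t) (2 * D + 1 - (i + j - 2 * t))

/-- The matrix `(∑_t β^r_{i,j,t} x^t_{i,j})_{i,j=r}^D`; the sum runs over all `t` for which
`(i,j,t)` is an index. -/
noncomputable def blockMatrix (D : ℕ) (x : ℕ → ℕ → ℕ → ℝ) (r : ℕ) :
    Matrix (Finset.Icc r D) (Finset.Icc r D) ℝ :=
  Matrix.of fun i j =>
    ∑ t ∈ Finset.range (min (i : ℕ) (j : ℕ) + 1), (beta D r i j t : ℝ) * x i j t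

/-- The matrix `(∑_t β^r_{i,j,t} (x^0_{ν,0} - x^t_{i,j}))_{i,j=r}^D`. -/
noncomputable def blockMatrixCompl (D : ℕ) (x : ℕ → ℕ → ℕ → ℝ) (r : ℕ) :
    Matrix (Finset.Icc r D) (Finset.Icc r D) ℝ :=
  Matrix.of fun i j =>
    ∑ t ∈ Finset.range (min (i : ℕ) (j : ℕ) + 1),
      (beta D r i j t : ℝ) * (x (nu D i j t) 0 0 - x i j t)

/-- Feasibility for the semidefinite program. Here `x i j t` stands for `x^t_{i,j}`; the variables
are those with `(i,j,t)` in the index set, and the function `x` is extended by zero outside it. -/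
structure Feasible (D d : ℕ) (x : ℕ → ℕ → ℕ → ℝ) : Prop where
  extend_zero : ∀ i j t, ¬ IsIndex D i j t → x i j t = 0
  normalized : x 0 0 0 = 1
  bounds : ∀ i j t, IsIndex D i j t → 0 ≤ x i j t ∧ x i j t ≤ x i 0 0
  perm_small : ∀ i j t i' j' t', IsIndex D i j t → IsIndex D i' j' t' →
    i + j - 2 * t ≤ D →
    [i', j', i' + j' - 2 * t'].Perm [i, j, i + j - 2 * t] →
    x i j t = x i' j' t'
  perm_large : ∀ i j t i' j' t', IsIndex D i j t → IsIndex D i' j' t' →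
    D + 1 ≤ i + j - 2 * t → i + j - 2 * t ≤ 2 * D →
    [i', j', 2 * D + 1 - (i' + j' - 2 * t')].Perm [i, j, 2 * D + 1 - (i + j - 2 * t)] →
    x i j t = x i' j' t'
  distance : ∀ i j t, IsIndex D i j t →
    (∃ k ∈ ({i, j, i + j - 2 * t, 2 * D + 1 - (i + j - 2 * t)} : Set ℕ), 1 ≤ k ∧ k < d) →
    x i j t = 0
  posSemidef : ∀ r ≤ D, (blockMatrix D x r).PosSemidef
  posSemidef_compl : ∀ r ≤ D, (blockMatrixCompl D x r).PosSemidef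

/-- The objective function `∑_{i=0}^D C(2D+1, i) x^0_{i,0}`. -/
noncomputable def objective (D : ℕ) (x : ℕ → ℕ → ℕ → ℝ) : ℝ :=
  ∑ i ∈ Finset.range (D + 1), ((2 * D + 1).choose i : ℝ) * x i 0 0

/-- The values of the objective function at the feasible points. -/
def feasibleValues (D d : ℕ) : Set ℝ :=
  {v | ∃ x : ℕ → ℕ → ℕ → ℝ, Feasible D d x ∧ objective D x = v}

/-- The optimum of the semidefinite program. -/
noncomputable def sdpOptimum (D d : ℕ) : ℝ := sSup (feasibleValues D d)

end FoldedCubeSDP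

/-! A code `C` in the folded cube lifts to the set `S` of all representatives of its vertices: `S`
is closed under complement, has `2|C|` words, and has Hamming distance at least `d`, since a path in
the folded cube is no longer than the Hamming distance of representatives and complementary words
are at distance `2D+1 ≥ d`.

For words `v, w`, count the `u` for which `u`, `u ∆ v`, `u ∆ w` all lie in `S`, average over
coordinate permutations, and normalize by `|S|`. The average `avg` depends only on `|v|, |w|, |v ∩
w|` (`avg_congr`), and these values form the feasible point `codePoint`. Translating `u` by `v` and
complementing words give the symmetry conditions. The objective value is `|C|`, because `avg S v ∅`
sums to `|S|` over all `v` and complementation pairs the sets of size at most `D` with the others.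

Semidefiniteness: `avg` is a nonnegative combination of rank one matrices indexed by `u ∈ S`, and
the complementary matrix is one indexed by `u ∉ S`. The blocks are compressions of these matrices
(`posSemidef_block`). The test vectors are supported on one level `|v| = i`, with entries the
product of `r` differences of indicators of paired coordinates. A generating function shows that
they produce exactly `2 ^ r * β` (`sum_pairSign_eq_beta`). No full block diagonalization is needed,
as only this direction is used.

Finally, the feasible set is closed and lies in the cube `[0,1]`, so it is compact and the maximum
is attained. -/

open scoped symmDiff

namespace FoldedCubeSDP

/-! ## Signed counting of pairs of sets -/

section GeneratingFunction

variable {R : Type*} [CommRing R]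

/-- The product of `[m + 2k ∈ v] - [m + 2k + 1 ∈ v]` over `k < r`. -/
def pairSign (R : Type*) [CommRing R] (m r : ℕ) (v : Finset ℕ) : R :=
  ∏ k ∈ Finset.range r, ((if m + 2 * k ∈ v then 1 else 0) - (if m + 2 * k + 1 ∈ v then 1 else 0))

/-- The weight `x ^ |v| * a ^ |v ∩ w| * b ^ |w \ v|` of a pair of subsets of `{0, ..., N - 1}`. -/
def pairWeight (x a b : R) (N : ℕ) (v w : Finset ℕ) : R :=
  ∏ c ∈ Finset.range N,
    if c ∈ v then (if c ∈ w then x * a else x) else (if c ∈ w then b else 1)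

theorem pairSign_insert {m r c : ℕ} (hc : m + 2 * r ≤ c) (v : Finset ℕ) :
    pairSign R m r (insert c v) = pairSign R m r v := by
  refine Finset.prod_congr rfl fun k hk => ?_
  have := Finset.mem_range.1 hk
  simp only [Finset.mem_insert, show m + 2 * k ≠ c by omega, show m + 2 * k + 1 ≠ c by omega, false_or]

theorem pairWeight_insert_left (x a b : R) {N c : ℕ} (hc : N ≤ c) (v w : Finset ℕ) :
    pairWeight x a b N (insert c v) w = pairWeight x a b N v w := by
  refine Finset.prod_congr rfl fun k hk => ?_
  have := Finset.mem_range.1 hk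
  simp only [Finset.mem_insert, show k ≠ c by omega, false_or]

theorem pairWeight_insert_right (x a b : R) {N c : ℕ} (hc : N ≤ c) (v w : Finset ℕ) :
    pairWeight x a b N v (insert c w) = pairWeight x a b N v w := by
  refine Finset.prod_congr rfl fun k hk => ?_
  have := Finset.mem_range.1 hk
  simp only [Finset.mem_insert, show k ≠ c by omega, false_or]

theorem pairWeight_eq (x a b : R) {N : ℕ} {v w : Finset ℕ} (hv : v ⊆ Finset.range N)
    (hw : w ⊆ Finset.range N) :
    pairWeight x a b N v w = x ^ v.card * a ^ (v ∩ w).card * b ^ (w \ v).card := by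
  have h : ∀ c, (if c ∈ v then (if c ∈ w then x * a else x) else (if c ∈ w then b else 1)) =
      (if c ∈ v then x else 1) * (if c ∈ v ∩ w then a else 1) * (if c ∈ w \ v then b else 1) := by
    intro c
    by_cases h1 : c ∈ v <;> by_cases h2 : c ∈ w <;> simp [h1, h2]
  have key : ∀ (y : R) (s : Finset ℕ), s ⊆ Finset.range N →
      ∏ c ∈ Finset.range N, (if c ∈ s then y else 1) = y ^ s.card := by
    intro y s hs
    rw [Finset.prod_ite_mem, Finset.inter_eq_right.2 hs, Finset.prod_const]
  rw [pairWeight, Finset.prod_congr rfl fun c _ => h c, Finset.prod_mul_distrib,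
    Finset.prod_mul_distrib, key x v hv, key a _ (Finset.inter_subset_left.trans hv),
    key b _ (Finset.sdiff_subset.trans hw)]

theorem sum_powerset_range_succ_pair (N : ℕ) (h : Finset ℕ → Finset ℕ → R) :
    ∑ v ∈ (Finset.range (N + 1)).powerset, ∑ w ∈ (Finset.range (N + 1)).powerset, h v w =
      ∑ v ∈ (Finset.range N).powerset, ∑ w ∈ (Finset.range N).powerset,
        (h v w + h v (insert N w) + (h (insert N v) w + h (insert N v) (insert N w))) := by
  have hN : N ∉ Finset.range N := Finset.notMem_range_self
  simp only [Finset.range_add_one, Finset.sum_powerset_insert hN, Finset.sum_add_distrib]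

theorem sum_pairWeight (x a b : R) (m : ℕ) :
    ∑ v ∈ (Finset.range m).powerset, ∑ w ∈ (Finset.range m).powerset, pairWeight x a b m v w =
      (1 + b + x * (1 + a)) ^ m := by
  induction m with
  | zero => simp [pairWeight]
  | succ m ih =>
    rw [sum_powerset_range_succ_pair, pow_succ, ← ih, Finset.sum_mul]
    refine Finset.sum_congr rfl fun v hv => ?_
    rw [Finset.sum_mul]
    refine Finset.sum_congr rfl fun w hw => ?_
    have h1 : m ∉ v := fun h => Finset.notMem_range_self (Finset.mem_powerset.1 hv h)
    have h2 : m ∉ w := fun h => Finset.notMem_range_self (Finset.mem_powerset.1 hw h)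
    have e : ∀ v w, pairWeight x a b (m + 1) v w = pairWeight x a b m v w *
        if m ∈ v then (if m ∈ w then x * a else x) else (if m ∈ w then b else 1) :=
      fun v w => Finset.prod_range_succ _ _
    simp only [e, pairWeight_insert_left x a b le_rfl, pairWeight_insert_right x a b le_rfl, h1, h2,
      Finset.mem_insert_self, if_true, if_false]
    ring

/-- The sum factors over the `m` free coordinates and the `r` pairs. On a pair the sign vanishes
unless `v` and `w` each contain exactly one of its two points: equal choices give `x * a` twice,
different choices give `-(x * b)` twice. -/
theorem sum_pairSign_pairWeight (x a b : R) (m r : ℕ) :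
    ∑ v ∈ (Finset.range (m + 2 * r)).powerset, ∑ w ∈ (Finset.range (m + 2 * r)).powerset,
        pairSign R m r v * pairSign R m r w * pairWeight x a b (m + 2 * r) v w =
      (1 + b + x * (1 + a)) ^ m * (2 * x * (a - b)) ^ r := by
  induction r with
  | zero => simpa [pairSign] using sum_pairWeight x a b m
  | succ r ih =>
    rw [show m + 2 * (r + 1) = m + 2 * r + 1 + 1 by ring, sum_powerset_range_succ_pair,
      sum_powerset_range_succ_pair, pow_succ, ← mul_assoc, ← ih, Finset.sum_mul]
    refine Finset.sum_congr rfl fun v hv => ?_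
    rw [Finset.sum_mul]
    refine Finset.sum_congr rfl fun w hw => ?_
    rw [Finset.mem_powerset] at hv hw
    have h1 : m + 2 * r ∉ v := fun h => by have := Finset.mem_range.1 (hv h); omega
    have h2 : m + 2 * r ∉ w := fun h => by have := Finset.mem_range.1 (hw h); omega
    have h3 : m + 2 * r + 1 ∉ v := fun h => by have := Finset.mem_range.1 (hv h); omega
    have h4 : m + 2 * r + 1 ∉ w := fun h => by have := Finset.mem_range.1 (hw h); omega
    have e : ∀ v w, pairWeight x a b (m + 2 * r + 1 + 1) v w = pairWeight x a b (m + 2 * r) v w *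
        (if m + 2 * r ∈ v then (if m + 2 * r ∈ w then x * a else x)
          else (if m + 2 * r ∈ w then b else 1)) *
        (if m + 2 * r + 1 ∈ v then (if m + 2 * r + 1 ∈ w then x * a else x)
          else (if m + 2 * r + 1 ∈ w then b else 1)) := fun v w => by
      rw [pairWeight, Finset.prod_range_succ, Finset.prod_range_succ]; rfl
    have e' : ∀ v, pairSign R m (r + 1) v = pairSign R m r v *
        ((if m + 2 * r ∈ v then 1 else 0) - (if m + 2 * r + 1 ∈ v then 1 else 0)) :=
      fun v => Finset.prod_range_succ _ _
    have n1 : m + 2 * r ≠ m + 2 * r + 1 := by omega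
    have n2 : m + 2 * r + 1 ≠ m + 2 * r := by omega
    have l1 : m + 2 * r ≤ m + 2 * r + 1 := by omega
    simp only [e, e', pairWeight_insert_left x a b le_rfl, pairWeight_insert_right x a b le_rfl,
      pairWeight_insert_left x a b l1, pairWeight_insert_right x a b l1,
      pairSign_insert le_rfl, pairSign_insert l1, h1, h2, h3, h4, n1, n2, Finset.mem_insert,
      if_true, if_false, or_false, or_true]
    ring

end GeneratingFunction

theorem binom_natCast_sub (a k l : ℕ) :
    binom a ((k : ℤ) - l) = if l ≤ k then (a.choose (k - l) : ℤ) else 0 := by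
  unfold binom
  by_cases h : l ≤ k
  · rw [if_pos h, ← Nat.cast_sub h]
    by_cases h' : k - l ≤ a
    · rw [if_pos ⟨by positivity, by exact_mod_cast h'⟩]; simp
    · rw [if_neg (fun h'' => h' (by exact_mod_cast h''.2)),
        Nat.choose_eq_zero_of_lt (by omega)]; rfl
  · rw [if_neg h, if_neg (by omega)]

open Polynomial in
theorem coeff_generatingFunction {S : Type*} [CommRing S] (a b : S) {m r i : ℕ} (hri : r ≤ i)
    (him : i ≤ m + r) :
    ((1 + C b + X * (1 + C a)) ^ m * (2 * X * (C a - C b)) ^ r).coeff i =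
      2 ^ r * m.choose (i - r) * ((a - b) ^ r * (1 + a) ^ (i - r) * (1 + b) ^ (m - (i - r))) := by
  have e1 : (1 + C b + X * (1 + C a)) ^ m * (2 * X * (C a - C b)) ^ r =
      X ^ r * (∑ k ∈ Finset.range (m + 1),
        C (2 ^ r * m.choose k * ((a - b) ^ r * (1 + a) ^ k * (1 + b) ^ (m - k))) * X ^ k) := by
    rw [add_comm (1 + C b), add_pow, Finset.mul_sum, Finset.sum_mul]
    refine Finset.sum_congr rfl fun k _ => ?_
    simp only [map_mul, map_pow, map_sub, map_add, map_one, map_natCast, map_ofNat, mul_pow]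
    ring
  rw [e1, coeff_X_pow_mul', if_pos hri, finsetSum_coeff]
  simp only [coeff_C_mul_X_pow]
  rw [Finset.sum_ite_eq, if_pos (Finset.mem_range.2 (by omega))]

/-- Writing `a - b = a(1 + b) - b(1 + a)` before expanding the `r`-th power separates the two
variables in each term. This is the source of the alternating sum over `l` in `beta`. -/
theorem sub_pow_mul_eq_sum {S : Type*} [CommRing S] (a b : S) {m r i : ℕ} (hri : r ≤ i)
    (him : i ≤ m + r) :
    (a - b) ^ r * (1 + a) ^ (i - r) * (1 + b) ^ (m - (i - r)) =
      ∑ l ∈ Finset.range (r + 1), ((-1) ^ (r + l) * (r.choose l : S)) *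
        ((a ^ l * (1 + a) ^ (i - l)) * (b ^ (r - l) * (1 + b) ^ (m + r + l - i))) := by
  have h : a - b = a * (1 + b) + -(b * (1 + a)) := by ring
  rw [h, add_pow, Finset.sum_mul, Finset.sum_mul]
  refine Finset.sum_congr rfl fun l hl => ?_
  have hl' : l ≤ r := Nat.lt_succ_iff.1 (Finset.mem_range.1 hl)
  have p1 : i - l = (r - l) + (i - r) := by omega
  have p2 : m + r + l - i = l + (m - (i - r)) := by omega
  have p3 : (-1 : S) ^ (r - l) = (-1) ^ (r + l) := by
    obtain ⟨q, rfl⟩ := Nat.exists_eq_add_of_le hl'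
    rw [show l + q - l = q by omega, show l + q + l = q + 2 * l by ring, pow_add, pow_mul]
    simp
  rw [p1, p2, neg_pow, p3, mul_pow, mul_pow, pow_add, pow_add]
  ring

open Polynomial in
/-- The coefficient of `x ^ i * b ^ s * a ^ t` in the generating function. -/
theorem coeff_coeff_coeff_generatingFunction {m r i s t : ℕ} (hri : r ≤ i) (him : i ≤ m + r) :
    (((((1 + C X + X * (1 + C (C X))) ^ m * (2 * X * (C (C X) - C X)) ^ r : ℤ[X][X][X]).coeff
        i).coeff s).coeff t) =
      2 ^ r * ((m.choose (i - r) : ℤ) * ∑ l ∈ Finset.range (r + 1), (-1) ^ (r + l) * r.choose l *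
        (if l ≤ t then ((i - l).choose (t - l) : ℤ) else 0) *
        (if r - l ≤ s then ((m + r + l - i).choose (s - (r - l)) : ℤ) else 0)) := by
  rw [coeff_generatingFunction (C X : ℤ[X][X]) X hri him, sub_pow_mul_eq_sum _ _ hri him,
    Finset.mul_sum, finsetSum_coeff, finsetSum_coeff, Finset.mul_sum, Finset.mul_sum]
  refine Finset.sum_congr rfl fun l _ => ?_
  have e : (2 ^ r * (m.choose (i - r) : ℤ[X][X]) * ((-1) ^ (r + l) * (r.choose l : ℤ[X][X]) *
      ((C X ^ l * (1 + C X) ^ (i - l)) * (X ^ (r - l) * (1 + X) ^ (m + r + l - i))))) =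
      C (C (2 ^ r * (m.choose (i - r) : ℤ) * ((-1) ^ (r + l) * (r.choose l : ℤ))) *
        (X ^ l * (1 + X) ^ (i - l))) * (X ^ (r - l) * (1 + X) ^ (m + r + l - i)) := by
    simp only [map_mul, map_pow, map_add, map_one, map_natCast, map_neg, map_ofNat]
    ring
  have e3 : (if r - l ≤ s then (((m + r + l - i).choose (s - (r - l)) : ℕ) : ℤ[X]) else 0) =
      C (if r - l ≤ s then (((m + r + l - i).choose (s - (r - l)) : ℕ) : ℤ) else 0) := by
    split_ifs <;> simp
  rw [e, coeff_C_mul, coeff_X_pow_mul', coeff_one_add_X_pow, e3, coeff_mul_C, coeff_C_mul,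
    coeff_X_pow_mul', coeff_one_add_X_pow]
  ring

/-- Terms with `l > r` vanish. For `l ≤ r` every upper argument is nonnegative, so integer and
natural binomials can differ only through a negative lower argument, which the conditionals record.
-/
theorem beta_eq {D r i j t : ℕ} (hri : r ≤ i) (hi : i ≤ D) (htj : t ≤ j) :
    beta D r i j t =
      ((2 * D + 1 - 2 * r).choose (i - r) : ℤ) *
        ∑ l ∈ Finset.range (r + 1), (-1) ^ (r + l) * r.choose l *
          (if l ≤ t then ((i - l).choose (t - l) : ℤ) else 0) *
          (if r - l ≤ j - t then
            ((2 * D + 1 - 2 * r + r + l - i).choose (j - t - (r - l)) : ℤ) else 0) := by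
  unfold beta
  congr 1
  · rw [show (2 * D + 1 - 2 * r : ℤ) = ((2 * D + 1 - 2 * r : ℕ) : ℤ) by omega, binom_natCast_sub,
      if_pos hri]
  · symm
    refine Finset.sum_subset_zero_on_sdiff (Finset.range_mono (by omega)) ?_ ?_
    · intro l hl
      rw [Finset.mem_sdiff, Finset.mem_range, Finset.mem_range] at hl
      have : binom (r : ℤ) l = 0 := if_neg (by omega)
      simp [this]
    · intro l hl
      have hl' : l ≤ r := Nat.lt_succ_iff.1 (Finset.mem_range.1 hl)
      have b1 : binom (r : ℤ) l = r.choose l := by simpa using binom_natCast_sub r l 0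
      have b2 := binom_natCast_sub (i - l) t l
      have b3 := binom_natCast_sub (2 * D + 1 - 2 * r + r + l - i) (j - t) (r - l)
      rw [show ((i - l : ℕ) : ℤ) = i - l by omega] at b2
      rw [show ((2 * D + 1 - 2 * r + r + l - i : ℕ) : ℤ) = 2 * D + 1 + l - i - r by omega,
        show ((j - t : ℕ) : ℤ) - ((r - l : ℕ) : ℤ) = j - t - r + l by omega] at b3
      rw [b1, b2, b3]

open Polynomial in
theorem sum_pairSign_eq_beta {D r i j t : ℕ} (hri : r ≤ i) (hi : i ≤ D) (htj : t ≤ j) :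
    ∑ v ∈ (Finset.range (2 * D + 1)).powerset, ∑ w ∈ (Finset.range (2 * D + 1)).powerset,
      (if v.card = i ∧ w.card = j ∧ (v ∩ w).card = t then
        pairSign ℤ (2 * D + 1 - 2 * r) r v * pairSign ℤ (2 * D + 1 - 2 * r) r w else 0) =
      2 ^ r * beta D r i j t := by
  have hN : 2 * D + 1 - 2 * r + 2 * r = 2 * D + 1 := by omega
  -- The outer, middle and inner variables are `x`, `b`, `a`; their exponents are `|v|`, `|w \ v|`,
  -- `|v ∩ w|`, hence `j - t` in the middle.
  have h := congrArg (fun p : ℤ[X][X][X] => ((p.coeff i).coeff (j - t)).coeff t)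
    (sum_pairSign_pairWeight (X : ℤ[X][X][X]) (C (C X)) (C X) (2 * D + 1 - 2 * r) r)
  rw [coeff_coeff_coeff_generatingFunction hri (by omega), ← beta_eq hri hi htj, hN] at h
  rw [← h]
  simp only [finsetSum_coeff]
  refine Finset.sum_congr rfl fun v hv => Finset.sum_congr rfl fun w hw => ?_
  rw [pairWeight_eq _ _ _ (Finset.mem_powerset.1 hv) (Finset.mem_powerset.1 hw)]
  have hs : ∀ v, pairSign ℤ[X][X][X] (2 * D + 1 - 2 * r) r v =
      C (C (C (pairSign ℤ (2 * D + 1 - 2 * r) r v))) := by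
    intro v
    simp only [pairSign, map_prod, map_sub, apply_ite C, map_one, map_zero]
  have hcard : (w \ v).card + (v ∩ w).card = w.card := by
    rw [Finset.inter_comm, Finset.card_sdiff_add_card_inter]
  have e : pairSign ℤ[X][X][X] (2 * D + 1 - 2 * r) r v * pairSign ℤ[X][X][X] (2 * D + 1 - 2 * r) r w *
      (X ^ v.card * C (C X) ^ (v ∩ w).card * C X ^ (w \ v).card) =
      C (C (C (pairSign ℤ (2 * D + 1 - 2 * r) r v * pairSign ℤ (2 * D + 1 - 2 * r) r w) *
        X ^ (v ∩ w).card) * X ^ (w \ v).card) * X ^ v.card := by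
    rw [hs, hs]
    simp only [map_mul, map_pow]
    ring
  rw [e, coeff_C_mul_X_pow]
  by_cases h1 : v.card = i
  · rw [if_pos h1.symm, coeff_C_mul_X_pow]
    by_cases h2 : (w \ v).card = j - t
    · rw [if_pos h2.symm, coeff_C_mul_X_pow]
      by_cases h3 : (v ∩ w).card = t
      · rw [if_pos h3.symm, if_pos ⟨h1, by omega, h3⟩]
      · rw [if_neg (Ne.symm h3), if_neg (fun h => h3 h.2.2)]
    · rw [if_neg (Ne.symm h2), if_neg (fun h => h2 (by omega)), coeff_zero]
  · rw [if_neg (Ne.symm h1), if_neg (fun h => h1 h.1), coeff_zero, coeff_zero]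

end FoldedCubeSDP

namespace FoldedCubeSDP

/-! ## Block diagonalization -/

theorem sum_map_valEmbedding {A : Type*} [AddCommMonoid A] (n : ℕ) (f : Finset ℕ → A) :
    ∑ v : Finset (Fin n), f (v.map Fin.valEmbedding) = ∑ v ∈ (Finset.range n).powerset, f v := by
  refine Finset.sum_bij (fun v _ => v.map Fin.valEmbedding) ?_ ?_ ?_ fun _ _ => rfl
  · intro v _
    rw [Finset.mem_powerset]
    intro c hc
    obtain ⟨a, -, rfl⟩ := Finset.mem_map.1 hc
    exact Finset.mem_range.2 a.2
  · intro v _ w _ h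
    exact Finset.map_injective _ h
  · intro v hv
    rw [Finset.mem_powerset] at hv
    exact ⟨v.attachFin fun c hc => Finset.mem_range.1 (hv hc), Finset.mem_univ _,
      Finset.map_valEmbedding_attachFin _⟩

theorem sum_pairSign_fin_eq_beta {D r i j t : ℕ} (hri : r ≤ i) (hi : i ≤ D) (htj : t ≤ j) :
    ∑ v : Finset (Fin (2 * D + 1)), ∑ w : Finset (Fin (2 * D + 1)),
      (if v.card = i ∧ w.card = j ∧ (v ∩ w).card = t then
        pairSign ℝ (2 * D + 1 - 2 * r) r (v.map Fin.valEmbedding) *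
          pairSign ℝ (2 * D + 1 - 2 * r) r (w.map Fin.valEmbedding) else 0) =
      2 ^ r * beta D r i j t := by
  have h := congrArg (Int.cast : ℤ → ℝ) (sum_pairSign_eq_beta hri hi htj)
  simp only [← sum_map_valEmbedding] at h
  have hs : ∀ v, ((pairSign ℤ (2 * D + 1 - 2 * r) r v : ℤ) : ℝ) =
      pairSign ℝ (2 * D + 1 - 2 * r) r v := by
    intro v
    simp [pairSign]
  push_cast [hs] at h
  rw [← h]
  refine Finset.sum_congr rfl fun v _ => Finset.sum_congr rfl fun w _ => ?_
  simp only [← Finset.map_inter, Finset.card_map]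

/-- Column `i` of `B` is the signed test vector restricted to sets of size `i`. Sorting the entries
of `Bᴴ * M * B` by `|v ∩ w|` turns them into `2 ^ r` times the block, so the block inherits
semidefiniteness. -/
theorem posSemidef_block {D r : ℕ}
    {M : Matrix (Finset (Fin (2 * D + 1))) (Finset (Fin (2 * D + 1))) ℝ} (hM : M.PosSemidef)
    (y : ℕ → ℕ → ℕ → ℝ)
    (hy : ∀ v w, v.card ≤ D → w.card ≤ D → M v w = y v.card w.card (v ∩ w).card) :
    (Matrix.of fun i j : Finset.Icc r D => ∑ t ∈ Finset.range (min (i : ℕ) (j : ℕ) + 1),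
      (beta D r i j t : ℝ) * y i j t).PosSemidef := by
  let F : Finset (Fin (2 * D + 1)) → ℝ := fun v =>
    pairSign ℝ (2 * D + 1 - 2 * r) r (v.map Fin.valEmbedding)
  let B : Matrix (Finset (Fin (2 * D + 1))) (Finset.Icc r D) ℝ :=
    Matrix.of fun v i => if v.card = i then F v else 0
  have key : (Matrix.of fun i j : Finset.Icc r D =>
      ∑ t ∈ Finset.range (min (i : ℕ) (j : ℕ) + 1), (beta D r i j t : ℝ) * y i j t) =
      ((2 : ℝ) ^ r)⁻¹ • (B.conjTranspose * M * B) := by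
    ext i j
    obtain ⟨hri, hiD⟩ := Finset.mem_Icc.1 i.2
    obtain ⟨hrj, hjD⟩ := Finset.mem_Icc.1 j.2
    rw [Matrix.smul_apply, smul_eq_mul, eq_inv_mul_iff_mul_eq₀ (by positivity), Matrix.of_apply,
      Finset.mul_sum, Matrix.mul_apply]
    simp only [Matrix.mul_apply, Matrix.conjTranspose_apply, star_trivial, Finset.sum_mul]
    rw [Finset.sum_comm (γ := Finset (Fin (2 * D + 1)))]
    have e : ∀ t ∈ Finset.range (min (i : ℕ) (j : ℕ) + 1),
        (2 : ℝ) ^ r * ((beta D r i j t : ℝ) * y i j t) =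
        ∑ v : Finset (Fin (2 * D + 1)), ∑ w : Finset (Fin (2 * D + 1)),
          if (v ∩ w).card = t then (if v.card = i ∧ w.card = j then F v * F w * y i j t else 0)
            else 0 := by
      intro t ht
      have ht' := Finset.mem_range.1 ht
      rw [← mul_assoc, ← sum_pairSign_fin_eq_beta hri hiD (by omega), Finset.sum_mul]
      refine Finset.sum_congr rfl fun v _ => ?_
      rw [Finset.sum_mul]
      refine Finset.sum_congr rfl fun w _ => ?_
      by_cases h1 : (v ∩ w).card = t <;> by_cases h2 : v.card = i <;>
        by_cases h3 : w.card = j <;> simp [h1, h2, h3, F]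
    rw [Finset.sum_congr rfl e, Finset.sum_comm]
    refine Finset.sum_congr rfl fun v _ => ?_
    rw [Finset.sum_comm]
    refine Finset.sum_congr rfl fun w _ => ?_
    rw [Finset.sum_ite_eq]
    by_cases h2 : v.card = i
    · by_cases h3 : w.card = j
      · have hl : (v ∩ w).card ≤ v.card := Finset.card_le_card Finset.inter_subset_left
        have hr : (v ∩ w).card ≤ w.card := Finset.card_le_card Finset.inter_subset_right
        rw [if_pos (Finset.mem_range.2 (by omega)), if_pos ⟨h2, h3⟩, hy v w (by omega) (by omega),
          h2, h3]
        simp only [B, Matrix.of_apply, h2, h3, if_true]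
        ring
      · simp [B, h3]
    · simp [B, h2]
  rw [key]
  exact (hM.conjTranspose_mul_mul_same B).smul (by positivity)

end FoldedCubeSDP

namespace FoldedCubeSDP

/-! ## Averaged triple counts of a self-complementary binary code -/

section Average

variable {n : ℕ}

/-- The indicator function of a set of words. -/
def ind (S : Finset (Finset (Fin n))) (u : Finset (Fin n)) : ℝ := if u ∈ S then 1 else 0

/-- The number of words `u` such that `u`, `u ∆ v` and `u ∆ w` are in the code. -/
def tripleCount (S : Finset (Finset (Fin n))) (v w : Finset (Fin n)) : ℝ :=
  ∑ u, ind S u * (ind S (u ∆ v) * ind S (u ∆ w))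

/-- The normalized average of `tripleCount` over all permutations of the coordinates. -/
noncomputable def avg (S : Finset (Finset (Fin n))) (v w : Finset (Fin n)) : ℝ :=
  ((S.card : ℝ) * (n.factorial : ℝ))⁻¹ *
    ∑ σ : Equiv.Perm (Fin n), tripleCount S (v.map σ.toEmbedding) (w.map σ.toEmbedding)

variable {S : Finset (Finset (Fin n))}

theorem ind_nonneg (u : Finset (Fin n)) : 0 ≤ ind S u := by
  unfold ind; split_ifs <;> norm_num

theorem ind_le_one (u : Finset (Fin n)) : ind S u ≤ 1 := by
  unfold ind; split_ifs <;> norm_num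

theorem ind_mul_self (u : Finset (Fin n)) : ind S u * ind S u = ind S u := by
  unfold ind; split_ifs <;> norm_num

theorem sum_ind : ∑ u, ind S u = S.card := by
  simp [ind]

theorem ind_compl (hc : ∀ u, uᶜ ∈ S ↔ u ∈ S) (u : Finset (Fin n)) : ind S uᶜ = ind S u := by
  simp only [ind, hc]

theorem map_symmDiff_perm (σ : Equiv.Perm (Fin n)) (v w : Finset (Fin n)) :
    (v ∆ w).map σ.toEmbedding = v.map σ.toEmbedding ∆ w.map σ.toEmbedding := by
  simp only [Finset.map_eq_image]
  exact Finset.image_symmDiff _ _ σ.injective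

theorem map_compl_perm (σ : Equiv.Perm (Fin n)) (v : Finset (Fin n)) :
    vᶜ.map σ.toEmbedding = (v.map σ.toEmbedding)ᶜ := by
  ext c
  simp

theorem symmDiff_compl_right (u w : Finset (Fin n)) : u ∆ wᶜ = (u ∆ w)ᶜ := by
  ext c
  by_cases h1 : c ∈ u <;> by_cases h2 : c ∈ w <;> simp [Finset.mem_symmDiff, h1, h2]

theorem card_symmDiff_add (v w : Finset (Fin n)) :
    (v ∆ w).card + 2 * (v ∩ w).card = v.card + w.card := by
  have h1 := Finset.card_sdiff_add_card_inter v w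
  have h2 := Finset.card_sdiff_add_card_inter w v
  rw [Finset.inter_comm] at h2
  have h3 : (v ∆ w).card = (v \ w).card + (w \ v).card :=
    Finset.card_union_of_disjoint disjoint_sdiff_sdiff
  omega

theorem tripleCount_comm (v w : Finset (Fin n)) : tripleCount S v w = tripleCount S w v :=
  Finset.sum_congr rfl fun u _ => by rw [mul_comm (ind S (u ∆ v))]

/-- Replacing `u` by `u ∆ v` exchanges the first two words of the triple and sends the third to `u ∆
w`. With commutativity this generates all permutations of the three mutual distances. -/
theorem tripleCount_shift (v w : Finset (Fin n)) :
    tripleCount S v (v ∆ w) = tripleCount S v w := by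
  unfold tripleCount
  rw [← Equiv.sum_comp (Function.Involutive.toPerm (fun u => u ∆ v) (symmDiff_left_involutive v))]
  refine Finset.sum_congr rfl fun u _ => ?_
  simp only [Function.Involutive.coe_toPerm]
  rw [symmDiff_assoc u v v, symmDiff_self, symmDiff_bot, ← symmDiff_assoc (u ∆ v) v w,
    symmDiff_assoc u v v, symmDiff_self, symmDiff_bot]
  ring

theorem tripleCount_compl_right (hc : ∀ u, uᶜ ∈ S ↔ u ∈ S) (v w : Finset (Fin n)) :
    tripleCount S v wᶜ = tripleCount S v w := by
  refine Finset.sum_congr rfl fun u _ => ?_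
  rw [symmDiff_compl_right, ind_compl hc]

theorem tripleCount_nonneg (v w : Finset (Fin n)) : 0 ≤ tripleCount S v w :=
  Finset.sum_nonneg fun _ _ => mul_nonneg (ind_nonneg _) (mul_nonneg (ind_nonneg _) (ind_nonneg _))

theorem tripleCount_empty (v : Finset (Fin n)) :
    tripleCount S v ∅ = ∑ u, ind S u * ind S (u ∆ v) := by
  refine Finset.sum_congr rfl fun u _ => ?_
  rw [show u ∆ ∅ = u from symmDiff_bot u, mul_left_comm, ind_mul_self, mul_comm]

theorem tripleCount_le (v w : Finset (Fin n)) : tripleCount S v w ≤ tripleCount S v ∅ := by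
  rw [tripleCount_empty]
  refine Finset.sum_le_sum fun u _ => mul_le_mul_of_nonneg_left ?_ (ind_nonneg _)
  exact mul_le_of_le_one_right (ind_nonneg _) (ind_le_one _)

theorem tripleCount_symmDiff_empty (v w : Finset (Fin n)) :
    tripleCount S (v ∆ w) ∅ = ∑ u, ind S (u ∆ v) * ind S (u ∆ w) := by
  rw [tripleCount_empty, ← Equiv.sum_comp (Function.Involutive.toPerm (fun u => u ∆ v) (symmDiff_left_involutive v))]
  refine Finset.sum_congr rfl fun u _ => ?_
  simp only [Function.Involutive.coe_toPerm]
  rw [← symmDiff_assoc, symmDiff_assoc u v v, symmDiff_self, symmDiff_bot]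

theorem tripleCount_eq_zero {d : ℕ} (hd : ∀ u ∈ S, ∀ v ∈ S, u ≠ v → d ≤ (u ∆ v).card)
    {v : Finset (Fin n)} (h1 : 1 ≤ v.card) (h2 : v.card < d) (w : Finset (Fin n)) :
    tripleCount S v w = 0 := by
  refine Finset.sum_eq_zero fun u _ => ?_
  by_cases hu : u ∈ S
  · by_cases hv : u ∆ v ∈ S
    · have h := hd u hu _ hv fun h => by
        have : v = ∅ := symmDiff_eq_left.1 h.symm
        simp [this] at h1
      rw [symmDiff_symmDiff_cancel_left] at h
      omega
    · simp [ind, hv]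
  · simp [ind, hu]

theorem avg_comm (v w : Finset (Fin n)) : avg S v w = avg S w v := by
  unfold avg
  rw [Finset.sum_congr rfl fun σ _ => tripleCount_comm _ _]

theorem avg_symmDiff_right (v w : Finset (Fin n)) : avg S v (v ∆ w) = avg S v w := by
  unfold avg
  simp only [map_symmDiff_perm, tripleCount_shift]

theorem avg_compl_right (hc : ∀ u, uᶜ ∈ S ↔ u ∈ S) (v w : Finset (Fin n)) :
    avg S v wᶜ = avg S v w := by
  unfold avg
  simp only [map_compl_perm, tripleCount_compl_right hc]

theorem avg_map (τ : Equiv.Perm (Fin n)) (v w : Finset (Fin n)) :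
    avg S (v.map τ.toEmbedding) (w.map τ.toEmbedding) = avg S v w := by
  unfold avg
  rw [← Equiv.sum_comp (Equiv.mulRight τ)
    fun σ => tripleCount S (v.map σ.toEmbedding) (w.map σ.toEmbedding)]
  simp only [Finset.map_map]
  rfl

theorem avg_nonneg (v w : Finset (Fin n)) : 0 ≤ avg S v w :=
  mul_nonneg (by positivity) (Finset.sum_nonneg fun _ _ => tripleCount_nonneg _ _)

theorem avg_le (v w : Finset (Fin n)) : avg S v w ≤ avg S v ∅ := by
  refine mul_le_mul_of_nonneg_left (Finset.sum_le_sum fun σ _ => ?_) (by positivity)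
  rw [Finset.map_empty]
  exact tripleCount_le _ _

theorem avg_empty_empty (hS : S.Nonempty) : avg S ∅ ∅ = 1 := by
  have h : tripleCount S ∅ ∅ = S.card := by
    rw [tripleCount_empty, ← sum_ind]
    exact Finset.sum_congr rfl fun u _ => by
      rw [show u ∆ ∅ = u from symmDiff_bot u, ind_mul_self]
  have hS' : (S.card : ℝ) ≠ 0 := by exact_mod_cast hS.card_pos.ne'
  have hn : (n.factorial : ℝ) ≠ 0 := by exact_mod_cast n.factorial_ne_zero
  unfold avg
  simp only [Finset.map_empty, h, Finset.sum_const, Finset.card_univ, Fintype.card_perm,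
    Fintype.card_fin, nsmul_eq_mul]
  field_simp

theorem avg_eq_zero {d : ℕ} (hd : ∀ u ∈ S, ∀ v ∈ S, u ≠ v → d ≤ (u ∆ v).card)
    {v : Finset (Fin n)} (h1 : 1 ≤ v.card) (h2 : v.card < d) (w : Finset (Fin n)) :
    avg S v w = 0 := by
  unfold avg
  rw [Finset.sum_eq_zero, mul_zero]
  intro σ _
  exact tripleCount_eq_zero hd (by rwa [Finset.card_map]) (by rwa [Finset.card_map]) _

/-- For each permutation the sum counts all ordered pairs of words of `S`, namely `|S|²`; the
normalization removes one factor `|S|`. -/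
theorem sum_avg_empty (hS : S.Nonempty) : ∑ v, avg S v ∅ = S.card := by
  have h : ∀ σ : Equiv.Perm (Fin n),
      ∑ v : Finset (Fin n), tripleCount S (v.map σ.toEmbedding) ∅ = (S.card : ℝ) * S.card := by
    intro σ
    rw [Fintype.sum_equiv σ.finsetCongr (fun v => tripleCount S (v.map σ.toEmbedding) ∅)
      (fun v => tripleCount S v ∅) fun v => rfl]
    simp only [tripleCount_empty]
    rw [Finset.sum_comm]
    have : ∀ u, ∑ v, ind S u * ind S (u ∆ v) = ind S u * S.card := by
      intro u
      rw [← Finset.mul_sum, ← sum_ind (S := S)]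
      exact congrArg _ (Equiv.sum_comp (Function.Involutive.toPerm _ (symmDiff_right_involutive u)) (ind S))
    rw [Finset.sum_congr rfl fun u _ => this u, ← Finset.sum_mul, sum_ind]
  have hS' : (S.card : ℝ) ≠ 0 := by exact_mod_cast hS.card_pos.ne'
  have hn : (n.factorial : ℝ) ≠ 0 := by exact_mod_cast n.factorial_ne_zero
  unfold avg
  simp only [Finset.map_empty]
  rw [← Finset.mul_sum, Finset.sum_comm, Finset.sum_congr rfl fun σ _ => h σ]
  simp only [Finset.sum_const, Finset.card_univ, Fintype.card_perm, Fintype.card_fin, nsmul_eq_mul]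
  field_simp

/-- For fixed `σ` and `u` the summand is a nonnegative multiple of a rank one Gram matrix. The
weight `f` is free so as to serve both `u ∈ S` and `u ∉ S`. -/
theorem posSemidef_sum_symmDiff (c : ℝ) (hc : 0 ≤ c) (f : Finset (Fin n) → ℝ) (hf : ∀ u, 0 ≤ f u) :
    (Matrix.of fun v w : Finset (Fin n) => c * ∑ σ : Equiv.Perm (Fin n), ∑ u,
      f u * (ind S (u ∆ v.map σ.toEmbedding) * ind S (u ∆ w.map σ.toEmbedding))).PosSemidef := by
  have e : (Matrix.of fun v w : Finset (Fin n) => c * ∑ σ : Equiv.Perm (Fin n), ∑ u,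
      f u * (ind S (u ∆ v.map σ.toEmbedding) * ind S (u ∆ w.map σ.toEmbedding))) =
      c • ∑ σ : Equiv.Perm (Fin n), ∑ u, f u •
        Matrix.vecMulVec (fun v : Finset (Fin n) => ind S (u ∆ v.map σ.toEmbedding))
          (star fun v : Finset (Fin n) => ind S (u ∆ v.map σ.toEmbedding)) := by
    ext v w
    simp [Matrix.sum_apply, Matrix.vecMulVec_apply]
  rw [e]
  refine Matrix.PosSemidef.smul (Matrix.posSemidef_sum _ fun σ _ =>
    Matrix.posSemidef_sum _ fun u _ => ?_) hc
  exact (Matrix.posSemidef_vecMulVec_self_star _).smul (hf u)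

theorem posSemidef_avg : (Matrix.of (avg S)).PosSemidef :=
  posSemidef_sum_symmDiff _ (by positivity) (ind S) ind_nonneg

/-- By translation, `tripleCount S (v ∆ w) ∅` counts all `u` with `u ∆ v` and `u ∆ w` in `S`.
Subtracting those with `u ∈ S` leaves the weight `1 - ind S u`. -/
theorem posSemidef_avg_compl :
    (Matrix.of fun v w => avg S (v ∆ w) ∅ - avg S v w).PosSemidef := by
  have h := posSemidef_sum_symmDiff (S := S) ((S.card : ℝ) * (n.factorial : ℝ))⁻¹ (by positivity)
    (fun u => 1 - ind S u) (fun u => sub_nonneg.2 (ind_le_one u))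
  convert h using 4 with v w
  rw [avg, avg, ← mul_sub, ← Finset.sum_sub_distrib]
  refine congrArg _ (Finset.sum_congr rfl fun σ _ => ?_)
  rw [map_symmDiff_perm, Finset.map_empty, tripleCount_symmDiff_empty, tripleCount,
    ← Finset.sum_sub_distrib]
  exact Finset.sum_congr rfl fun u _ => by ring

/-- The three cardinalities determine the sizes of all four cells of the Venn diagram, so the cells
can be matched by bijections and glued. -/
theorem exists_perm_map_eq {v w v' w' : Finset (Fin n)} (hv : v'.card = v.card)
    (hw : w'.card = w.card) (hvw : (v' ∩ w').card = (v ∩ w).card) :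
    ∃ σ : Equiv.Perm (Fin n), v.map σ.toEmbedding = v' ∧ w.map σ.toEmbedding = w' := by
  let f : Finset (Fin n) → Finset (Fin n) → Fin n → Bool × Bool :=
    fun v w c => (decide (c ∈ v), decide (c ∈ w))
  have hf : ∀ v w : Finset (Fin n), ∀ k, Fintype.card {c // f v w c = k} =
      match k with
      | (true, true) => (v ∩ w).card
      | (true, false) => v.card - (v ∩ w).card
      | (false, true) => w.card - (v ∩ w).card
      | (false, false) => n - (v.card + w.card - (v ∩ w).card) := by
    intro v w k
    rw [Fintype.card_subtype]
    have h1 := Finset.card_sdiff_add_card_inter v w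
    have h2 := Finset.card_sdiff_add_card_inter w v
    have h3 := Finset.card_union_add_card_inter v w
    have h4 := Finset.card_compl (v ∪ w)
    rw [Fintype.card_fin] at h4
    have h5 := Finset.inter_comm v w
    rcases k with ⟨_ | _, _ | _⟩
    · rw [show (Finset.univ.filter fun c => f v w c = (false, false)) = (v ∪ w)ᶜ by ext; simp [f]]
      simp only; omega
    · rw [show (Finset.univ.filter fun c => f v w c = (false, true)) = w \ v by
        ext; simp [f, and_comm]]
      simp only; rw [h5]; omega
    · rw [show (Finset.univ.filter fun c => f v w c = (true, false)) = v \ w by ext; simp [f]]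
      simp only; omega
    · rw [show (Finset.univ.filter fun c => f v w c = (true, true)) = v ∩ w by ext; simp [f]]
  have hfib : ∀ k, Fintype.card {c // f v w c = k} = Fintype.card {c // f v' w' c = k} := by
    intro k
    rw [hf, hf, hv, hw, hvw]
  let σ : Equiv.Perm (Fin n) := Equiv.ofFiberEquiv fun k => Fintype.equivOfCardEq (hfib k)
  have hσ : ∀ c, f v' w' (σ c) = f v w c := Equiv.ofFiberEquiv_map _
  refine ⟨σ, ?_, ?_⟩
  · ext c
    obtain ⟨b, rfl⟩ := σ.surjective c
    have := congrArg Prod.fst (hσ b)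
    simp only [f, decide_eq_decide] at this
    simp [this]
  · ext c
    obtain ⟨b, rfl⟩ := σ.surjective c
    have := congrArg Prod.snd (hσ b)
    simp only [f, decide_eq_decide] at this
    simp [this]

theorem avg_congr {v w v' w' : Finset (Fin n)} (hv : v'.card = v.card)
    (hw : w'.card = w.card) (hvw : (v' ∩ w').card = (v ∩ w).card) : avg S v' w' = avg S v w := by
  obtain ⟨σ, rfl, rfl⟩ := exists_perm_map_eq hv hw hvw
  exact avg_map σ v w

end Average

/-! ## The feasible point of a self-complementary binary code -/

section CodePoint

variable {D : ℕ}

open scoped Classical in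
/-- The point of the semidefinite program given by the averaged triple counts of a code. -/
noncomputable def codePoint (D : ℕ) (S : Finset (Finset (Fin (2 * D + 1)))) (i j t : ℕ) : ℝ :=
  if h : ∃ p : Finset (Fin (2 * D + 1)) × Finset (Fin (2 * D + 1)),
      p.1.card = i ∧ p.2.card = j ∧ (p.1 ∩ p.2).card = t ∧ i ≤ D ∧ j ≤ D
    then avg S h.choose.1 h.choose.2 else 0

variable {S : Finset (Finset (Fin (2 * D + 1)))}

theorem codePoint_card {v w : Finset (Fin (2 * D + 1))} {i j t : ℕ} (hi : v.card = i)
    (hj : w.card = j) (ht : (v ∩ w).card = t) (hiD : i ≤ D) (hjD : j ≤ D) :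
    codePoint D S i j t = avg S v w := by
  have h : ∃ p : Finset (Fin (2 * D + 1)) × Finset (Fin (2 * D + 1)),
      p.1.card = i ∧ p.2.card = j ∧ (p.1 ∩ p.2).card = t ∧ i ≤ D ∧ j ≤ D :=
    ⟨(v, w), hi, hj, ht, hiD, hjD⟩
  rw [codePoint, dif_pos h]
  obtain ⟨h1, h2, h3, -⟩ := h.choose_spec
  exact avg_congr (h1.trans hi.symm) (h2.trans hj.symm) (h3.trans ht.symm)

theorem codePoint_zero_zero {v : Finset (Fin (2 * D + 1))} {i : ℕ} (hi : v.card = i) (hiD : i ≤ D) :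
    codePoint D S i 0 0 = avg S v ∅ :=
  codePoint_card hi Finset.card_empty (by simp) hiD (Nat.zero_le _)

theorem IsIndex.exists_sets {i j t : ℕ} (h : IsIndex D i j t) :
    ∃ v w : Finset (Fin (2 * D + 1)), v.card = i ∧ w.card = j ∧ (v ∩ w).card = t := by
  obtain ⟨hti, htj, hi, hj, -⟩ := h
  obtain ⟨v, -, hv⟩ := Finset.exists_subset_card_eq
    (show i ≤ (Finset.univ : Finset (Fin (2 * D + 1))).card by rw [Finset.card_fin]; omega)
  obtain ⟨w₁, hw₁, hc₁⟩ := Finset.exists_subset_card_eq (show t ≤ v.card by omega)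
  obtain ⟨w₂, hw₂, hc₂⟩ := Finset.exists_subset_card_eq
    (show j - t ≤ vᶜ.card by rw [Finset.card_compl, Fintype.card_fin]; omega)
  have hd : Disjoint v w₂ := (disjoint_compl_right (a := v)).mono_right hw₂
  refine ⟨v, w₁ ∪ w₂, hv, ?_, ?_⟩
  · rw [Finset.card_union_of_disjoint (hd.mono_left hw₁)]
    omega
  · rw [Finset.inter_union_distrib_left, Finset.inter_eq_right.2 hw₁,
      Finset.disjoint_iff_inter_eq_empty.1 hd, Finset.union_empty, hc₁]

theorem codePoint_of_not_isIndex {i j t : ℕ} (h : ¬ IsIndex D i j t) : codePoint D S i j t = 0 := by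
  refine dif_neg ?_
  rintro ⟨⟨v, w⟩, h1, h2, h3, h4, h5⟩
  have h6 : (v ∩ w).card ≤ v.card := Finset.card_le_card Finset.inter_subset_left
  have h7 : (v ∩ w).card ≤ w.card := Finset.card_le_card Finset.inter_subset_right
  simp only at h1 h2 h3
  exact h ⟨by omega, by omega, h4, h5, by omega⟩

theorem perm_triple {a b c x y z : ℕ} (h : [a, b, c].Perm [x, y, z]) :
    (a = x ∧ b = y ∧ c = z) ∨ (a = x ∧ b = z ∧ c = y) ∨ (a = y ∧ b = x ∧ c = z) ∨
      (a = y ∧ b = z ∧ c = x) ∨ (a = z ∧ b = x ∧ c = y) ∨ (a = z ∧ b = y ∧ c = x) := by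
  have pair : ∀ {b c y z : ℕ}, [b, c].Perm [y, z] → (b = y ∧ c = z) ∨ (b = z ∧ c = y) := by
    intro b c y z h
    have hb : b ∈ [y, z] := h.subset (by simp)
    simp only [List.mem_cons, List.not_mem_nil, or_false] at hb
    rcases hb with rfl | rfl
    · have := h.cons_inv
      simp at this
      exact Or.inl ⟨rfl, this⟩
    · have := (h.trans (List.Perm.swap _ _ _)).cons_inv
      simp at this
      exact Or.inr ⟨rfl, this⟩
  have ha : a ∈ [x, y, z] := h.subset (by simp)
  simp only [List.mem_cons, List.not_mem_nil, or_false] at ha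
  rcases ha with rfl | rfl | rfl
  · rcases pair h.cons_inv with h | h <;> omega
  · rcases pair (h.trans (List.Perm.swap _ _ _)).cons_inv with h | h <;> omega
  · rcases pair (h.trans (((List.Perm.swap _ _ []).cons x).trans (List.Perm.swap _ _ _))).cons_inv
      with h | h <;> omega

/-- The value at a code of a variable depends only on the three pairwise distances, up to order:
`g c` is the size of the symmetric difference of two of the sets if the third has size `c`. -/
theorem codePoint_perm {v w z : Finset (Fin (2 * D + 1))} (g : ℕ → ℕ) (hv : v.card ≤ D)
    (hw : w.card ≤ D) (hz : z.card ≤ D) (hvz : avg S v z = avg S v w) (hwz : avg S w z = avg S v w)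
    (h1 : (v ∆ w).card = g z.card) (h2 : (v ∆ z).card = g w.card) (h3 : (w ∆ z).card = g v.card)
    {i j c t : ℕ} (hp : [i, j, c].Perm [v.card, w.card, z.card]) (ht : g c + 2 * t = i + j) :
    codePoint D S i j t = avg S v w := by
  have k1 := card_symmDiff_add v w
  have k2 := card_symmDiff_add v z
  have k3 := card_symmDiff_add w z
  rcases perm_triple hp with ⟨rfl, rfl, rfl⟩ | ⟨rfl, rfl, rfl⟩ | ⟨rfl, rfl, rfl⟩ | ⟨rfl, rfl, rfl⟩ |
    ⟨rfl, rfl, rfl⟩ | ⟨rfl, rfl, rfl⟩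
  · exact codePoint_card rfl rfl (by omega) hv hw
  · exact (codePoint_card rfl rfl (by omega) hv hz).trans hvz
  · exact (codePoint_card rfl rfl (by rw [Finset.inter_comm]; omega) hw hv).trans (avg_comm _ _)
  · exact (codePoint_card rfl rfl (by omega) hw hz).trans hwz
  · exact (codePoint_card rfl rfl (by rw [Finset.inter_comm]; omega) hz hv).trans
      ((avg_comm _ _).trans hvz)
  · exact (codePoint_card rfl rfl (by rw [Finset.inter_comm]; omega) hz hw).trans
      ((avg_comm _ _).trans hwz)

theorem avg_symmDiff_left (v w : Finset (Fin (2 * D + 1))) : avg S w (v ∆ w) = avg S v w := by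
  rw [symmDiff_comm, avg_symmDiff_right, avg_comm]

theorem feasible_codePoint {d : ℕ} (hS : S.Nonempty) (hc : ∀ u, uᶜ ∈ S ↔ u ∈ S)
    (hd : ∀ u ∈ S, ∀ v ∈ S, u ≠ v → d ≤ (u ∆ v).card) : Feasible D d (codePoint D S) where
  extend_zero i j t h := codePoint_of_not_isIndex h
  normalized := by
    rw [codePoint_zero_zero Finset.card_empty (Nat.zero_le _), avg_empty_empty hS]
  bounds i j t h := by
    obtain ⟨v, w, hv, hw, ht⟩ := h.exists_sets
    rw [codePoint_card hv hw ht h.2.2.1 h.2.2.2.1, codePoint_zero_zero hv h.2.2.1]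
    exact ⟨avg_nonneg _ _, avg_le _ _⟩
  perm_small i j t i' j' t' h h' hk hp := by
    obtain ⟨v, w, rfl, rfl, rfl⟩ := h.exists_sets
    have hcard := card_symmDiff_add v w
    obtain ⟨a1, a2, a3, a4, -⟩ := h
    obtain ⟨b1, b2, b3, b4, -⟩ := h'
    rw [codePoint_card rfl rfl rfl a3 a4]
    have e : v.card + w.card - 2 * (v ∩ w).card = (v ∆ w).card := by omega
    rw [e] at hk hp
    -- The third set is `v ∆ w`: any two of the three sets then have the third as symmetric
    -- difference.
    refine (codePoint_perm id a3 a4 hk (avg_symmDiff_right v w) (avg_symmDiff_left v w) rfl ?_ ?_ hp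
      (show i' + j' - 2 * t' + 2 * t' = i' + j' by omega)).symm
    · rw [symmDiff_symmDiff_cancel_left]; rfl
    · rw [symmDiff_comm v w, symmDiff_symmDiff_cancel_left]; rfl
  perm_large i j t i' j' t' h h' hk hk' hp := by
    obtain ⟨v, w, rfl, rfl, rfl⟩ := h.exists_sets
    have hcard := card_symmDiff_add v w
    obtain ⟨a1, a2, a3, a4, -⟩ := h
    obtain ⟨b1, b2, b3, b4, -⟩ := h'
    rw [codePoint_card rfl rfl rfl a3 a4]
    have hz : ((v ∆ w)ᶜ).card = 2 * D + 1 - (v ∆ w).card := by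
      rw [Finset.card_compl, Fintype.card_fin]
    have e : 2 * D + 1 - (v.card + w.card - 2 * (v ∩ w).card) = ((v ∆ w)ᶜ).card := by omega
    rw [e] at hp
    -- Here `v ∆ w` has more than `D` elements, so its complement is the third set, and each
    -- symmetric difference is the complement of the remaining set.
    refine (codePoint_perm (fun c => 2 * D + 1 - c) a3 a4 (by omega)
      ((avg_compl_right hc _ _).trans (avg_symmDiff_right v w))
      ((avg_compl_right hc _ _).trans (avg_symmDiff_left v w)) (by omega) ?_ ?_ hp ?_).symm
    · rw [symmDiff_compl_right, symmDiff_symmDiff_cancel_left, Finset.card_compl, Fintype.card_fin]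
    · rw [symmDiff_compl_right, symmDiff_comm v w, symmDiff_symmDiff_cancel_left,
        Finset.card_compl, Fintype.card_fin]
    · omega
  distance i j t h := by
    rintro ⟨k, hk, hk1, hkd⟩
    obtain ⟨v, w, rfl, rfl, rfl⟩ := h.exists_sets
    have hcard := card_symmDiff_add v w
    rw [codePoint_card rfl rfl rfl h.2.2.1 h.2.2.2.1]
    simp only [Set.mem_insert_iff, Set.mem_singleton_iff] at hk
    rcases hk with rfl | rfl | rfl | rfl
    · exact avg_eq_zero hd hk1 hkd _
    · rw [avg_comm]
      exact avg_eq_zero hd hk1 hkd _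
    · rw [← avg_symmDiff_right, avg_comm]
      exact avg_eq_zero hd (by omega) (by omega) _
    · have hz : ((v ∆ w)ᶜ).card = 2 * D + 1 - (v ∆ w).card := by
        rw [Finset.card_compl, Fintype.card_fin]
      rw [← avg_symmDiff_right, ← avg_compl_right hc, avg_comm]
      exact avg_eq_zero hd (by omega) (by omega) _
  posSemidef r hr := posSemidef_block posSemidef_avg _ fun v w hv hw =>
    (codePoint_card rfl rfl rfl hv hw).symm
  posSemidef_compl r hr := by
    refine posSemidef_block (posSemidef_avg_compl (S := S))
      (fun i j t => codePoint D S (nu D i j t) 0 0 - codePoint D S i j t) fun v w hv hw => ?_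
    have hcard := card_symmDiff_add v w
    have hz : ((v ∆ w)ᶜ).card = 2 * D + 1 - (v ∆ w).card := by
      rw [Finset.card_compl, Fintype.card_fin]
    rw [Matrix.of_apply, codePoint_card rfl rfl rfl hv hw]
    congr 1
    unfold nu
    by_cases hk : (v ∆ w).card ≤ D
    · exact (codePoint_zero_zero (by omega) (by omega)).symm
    -- The set of size `ν` is now the complement of `v ∆ w`, which has the same average against `∅`.
    · rw [avg_comm, ← avg_compl_right hc, avg_comm]
      exact (codePoint_zero_zero (by omega) (by omega)).symm

/-- Since `2D+1` is odd, exactly one of `v`, `vᶜ` has size at most `D`, and both have the same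
average against `∅`; so the objective is half of the full sum. -/
theorem two_mul_objective_codePoint (hS : S.Nonempty) (hc : ∀ u, uᶜ ∈ S ↔ u ∈ S) :
    2 * objective D (codePoint D S) = S.card := by
  have h1 : objective D (codePoint D S) =
      ∑ v ∈ Finset.univ.filter (fun v : Finset (Fin (2 * D + 1)) => v.card ≤ D), avg S v ∅ := by
    rw [← Finset.sum_fiberwise_of_maps_to (t := Finset.range (D + 1)) (g := Finset.card)
      fun v hv => Finset.mem_range.2 (Nat.lt_succ_of_le (Finset.mem_filter.1 hv).2)]
    refine Finset.sum_congr rfl fun i hi => ?_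
    have hi' : i ≤ D := Nat.lt_succ_iff.1 (Finset.mem_range.1 hi)
    have e : (Finset.univ.filter fun v : Finset (Fin (2 * D + 1)) => v.card ≤ D).filter
        (fun v => v.card = i) = Finset.powersetCard i Finset.univ := by
      ext v
      simp only [Finset.mem_filter, Finset.mem_univ, true_and, Finset.mem_powersetCard,
        Finset.subset_univ]
      omega
    rw [e, Finset.sum_congr rfl fun v hv =>
      (codePoint_zero_zero (S := S) (Finset.mem_powersetCard.1 hv).2 hi').symm, Finset.sum_const,
      Finset.card_powersetCard, Finset.card_fin, nsmul_eq_mul]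
  have h2 : ∑ v ∈ Finset.univ.filter (fun v : Finset (Fin (2 * D + 1)) => ¬ v.card ≤ D),
      avg S v ∅ =
      ∑ v ∈ Finset.univ.filter (fun v : Finset (Fin (2 * D + 1)) => v.card ≤ D), avg S v ∅ := by
    refine Finset.sum_bij (fun v _ => vᶜ) ?_ (fun v _ w _ h => compl_injective h) ?_ ?_
    · intro v hv
      simp only [Finset.mem_filter, Finset.mem_univ, true_and, Finset.card_compl,
        Fintype.card_fin] at hv ⊢
      omega
    · intro v hv
      refine ⟨vᶜ, ?_, compl_compl v⟩
      simp only [Finset.mem_filter, Finset.mem_univ, true_and, Finset.card_compl,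
        Fintype.card_fin] at hv ⊢
      omega
    · intro v _
      rw [avg_comm, ← avg_compl_right hc, avg_comm]
  rw [← sum_avg_empty hS, ← Finset.sum_filter_add_sum_filter_not Finset.univ
    (fun v : Finset (Fin (2 * D + 1)) => v.card ≤ D), h2, h1]
  ring

end CodePoint

end FoldedCubeSDP

namespace FoldedCubeSDP

/-! ## From codes in the folded cube to self-complementary binary codes -/

section Graph

variable {n : ℕ}

/-- The vertex of the folded cube represented by a set. -/
def vertexMk (u : Finset (Fin n)) : Vertex n :=
  ⟨s(u, uᶜ), u, uᶜ, Finset.inter_compl u, Finset.union_compl u, rfl⟩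

theorem vertexMk_surjective (z : Vertex n) : ∃ u, vertexMk u = z := by
  obtain ⟨_, u, u', h1, h2, rfl⟩ := z
  have : u' = uᶜ :=
    (IsCompl.of_eq (x := u) (y := u') (by simpa using h1) (by simpa using h2)).compl_eq.symm
  subst this
  exact ⟨u, rfl⟩

theorem vertexMk_eq_iff {u v : Finset (Fin n)} : vertexMk u = vertexMk v ↔ u = v ∨ u = vᶜ := by
  rw [vertexMk, vertexMk, Subtype.mk.injEq, Sym2.eq_iff]
  constructor
  · rintro (h | h)
    · exact Or.inl h.1
    · exact Or.inr h.1
  · rintro (rfl | rfl)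
    · exact Or.inl ⟨rfl, rfl⟩
    · exact Or.inr ⟨rfl, compl_compl v⟩

theorem vertexMk_compl (u : Finset (Fin n)) : vertexMk uᶜ = vertexMk u :=
  vertexMk_eq_iff.2 (Or.inr rfl)

theorem exists_walk_length_le (k : ℕ) (u v : Finset (Fin n)) (h : (u ∆ v).card = k) :
    ∃ p : (foldedCube n).Walk (vertexMk u) (vertexMk v), p.length ≤ k := by
  induction k generalizing u with
  | zero =>
    rw [Finset.card_eq_zero, Finset.symmDiff_eq_empty] at h
    subst h
    exact ⟨.nil, le_rfl⟩
  | succ k ih =>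
    obtain ⟨a, ha⟩ : (u ∆ v).Nonempty := Finset.card_pos.1 (by omega)
    have h' : ((u ∆ {a}) ∆ v).card = k := by
      have e : (u ∆ {a}) ∆ v = (u ∆ v).erase a := by
        rw [symmDiff_right_comm]
        ext c
        by_cases hc : c = a
        · subst hc
          simp [Finset.mem_symmDiff (a := c) (s := u ∆ v), ha]
        · simp [Finset.mem_symmDiff (a := c) (s := u ∆ v), hc]
      rw [e, Finset.card_erase_of_mem ha]
      omega
    obtain ⟨p, hp⟩ := ih _ h'
    -- Flipping one coordinate fixes the vertex when `n = 1`; no edge is then traversed, which is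
    -- why the length is only bounded by `k`.
    by_cases he : vertexMk u = vertexMk (u ∆ {a})
    · rw [he]
      exact ⟨p, by omega⟩
    · have hadj : (foldedCube n).Adj (vertexMk u) (vertexMk (u ∆ {a})) := by
        refine ⟨he, u, Sym2.mem_mk_left _ _, u ∆ {a}, Sym2.mem_mk_left _ _, ?_⟩
        rw [symmDiff_symmDiff_cancel_left, Finset.card_singleton]
      exact ⟨.cons hadj p, by rw [SimpleGraph.Walk.length_cons]; omega⟩

theorem dist_vertexMk_le (u v : Finset (Fin n)) :
    (foldedCube n).dist (vertexMk u) (vertexMk v) ≤ (u ∆ v).card := by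
  obtain ⟨p, hp⟩ := exists_walk_length_le _ u v rfl
  exact (SimpleGraph.dist_le p).trans hp

open scoped Classical in
/-- The binary code of all representatives of the elements of a code in the folded cube. -/
noncomputable def wordsOf (C : Finset (Vertex n)) : Finset (Finset (Fin n)) :=
  Finset.univ.filter fun u => vertexMk u ∈ C

theorem mem_wordsOf {C : Finset (Vertex n)} {u : Finset (Fin n)} :
    u ∈ wordsOf C ↔ vertexMk u ∈ C := by
  simp [wordsOf]

theorem compl_mem_wordsOf {C : Finset (Vertex n)} (u : Finset (Fin n)) :
    uᶜ ∈ wordsOf C ↔ u ∈ wordsOf C := by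
  rw [mem_wordsOf, mem_wordsOf, vertexMk_compl]

theorem card_wordsOf (hn : 0 < n) (C : Finset (Vertex n)) : (wordsOf C).card = 2 * C.card := by
  classical
  rw [Finset.card_eq_sum_card_fiberwise (f := vertexMk) (t := C) fun u hu => mem_wordsOf.1 hu,
    mul_comm, ← smul_eq_mul, ← Finset.sum_const]
  refine Finset.sum_congr rfl fun z hz => ?_
  obtain ⟨u, rfl⟩ := vertexMk_surjective z
  have e : (wordsOf C).filter (fun v => vertexMk v = vertexMk u) = {u, uᶜ} := by
    ext v
    rw [Finset.mem_filter, mem_wordsOf, Finset.mem_insert, Finset.mem_singleton, vertexMk_eq_iff]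
    refine ⟨fun h => h.2, fun h => ⟨?_, h⟩⟩
    rwa [vertexMk_eq_iff.2 h]
  have : NeZero n := ⟨hn.ne'⟩
  rw [e, Finset.card_pair]
  intro h
  have := congrArg (fun s : Finset (Fin n) => (0 : Fin n) ∈ s) h
  simp at this

theorem le_card_symmDiff_wordsOf {d : ℕ} (hd : d ≤ n) {C : Finset (Vertex n)}
    (hC : IsCode (foldedCube n) d C) :
    ∀ u ∈ wordsOf C, ∀ v ∈ wordsOf C, u ≠ v → d ≤ (u ∆ v).card := by
  intro u hu v hv huv
  by_cases h : vertexMk u = vertexMk v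
  -- Distinct words of one vertex are complementary, hence at distance `n`; this is where `d ≤ n`
  -- enters.
  · rcases vertexMk_eq_iff.1 h with h | rfl
    · exact absurd h huv
    · rw [symmDiff_comm, symmDiff_compl_right, symmDiff_self]
      simpa using hd
  · exact (hC.2 _ (mem_wordsOf.1 hu) _ (mem_wordsOf.1 hv) h).trans (dist_vertexMk_le u v)

theorem card_mem_feasibleValues {D d : ℕ} (hd : d ≤ 2 * D + 1) {C : Finset (Vertex (2 * D + 1))}
    (hC : IsCode (foldedCube (2 * D + 1)) d C) : (C.card : ℝ) ∈ feasibleValues D d := by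
  have hcard := card_wordsOf (Nat.succ_pos (2 * D)) C
  have hS : (wordsOf C).Nonempty := Finset.card_pos.1 (by have := hC.1.card_pos; omega)
  refine ⟨codePoint D (wordsOf C), feasible_codePoint hS compl_mem_wordsOf
    (le_card_symmDiff_wordsOf hd hC), ?_⟩
  have h := two_mul_objective_codePoint hS compl_mem_wordsOf
  rw [hcard] at h
  push_cast at h
  linarith

theorem maxCodeSize_mem_feasibleValues {D d : ℕ} (hd : d ≤ 2 * D + 1) :
    (maxCodeSize (foldedCube (2 * D + 1)) d : ℝ) ∈ feasibleValues D d := by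
  classical
  have hne : (Finset.univ.filter fun C : Finset (Vertex (2 * D + 1)) =>
      IsCode (foldedCube (2 * D + 1)) d C).Nonempty := by
    refine ⟨{vertexMk ∅}, ?_⟩
    rw [Finset.mem_filter]
    refine ⟨Finset.mem_univ _, Finset.singleton_nonempty _, fun x hx y hy hxy => ?_⟩
    rw [Finset.mem_singleton] at hx hy
    exact absurd (hx.trans hy.symm) hxy
  obtain ⟨C, hC, h⟩ := Finset.exists_mem_eq_sup _ hne Finset.card
  have h' : maxCodeSize (foldedCube (2 * D + 1)) d = C.card := by
    rw [← h, maxCodeSize]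
  rw [h']
  exact card_mem_feasibleValues hd (Finset.mem_filter.1 hC).2

end Graph

/-! ## Compactness of the feasible set -/

/-- The upper bound chains the constraints: `x i j t ≤ x i 0 0 = x 0 i 0 ≤ x 0 0 0 = 1`. Off the
index set, the extension by zero keeps the coordinates bounded. -/
theorem Feasible.mem_Icc {D d : ℕ} {x : ℕ → ℕ → ℕ → ℝ} (hx : Feasible D d x) :
    x ∈ Set.Icc (0 : ℕ → ℕ → ℕ → ℝ) 1 := by
  have h0 : ∀ j ≤ D, x j 0 0 ≤ 1 := by
    intro j hj
    rw [← hx.normalized, hx.perm_small j 0 0 0 j 0 ⟨by omega, by omega, hj, by omega, by omega⟩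
      ⟨by omega, by omega, by omega, hj, by omega⟩ (by omega) ?_]
    · exact (hx.bounds 0 j 0 ⟨by omega, by omega, by omega, hj, by omega⟩).2
    · simpa using List.Perm.swap j 0 [j]
  refine ⟨fun i j t => ?_, fun i j t => ?_⟩ <;> by_cases h : IsIndex D i j t
  · exact (hx.bounds i j t h).1
  · exact (hx.extend_zero i j t h).ge
  · exact (hx.bounds i j t h).2.trans (h0 i h.2.2.1)
  · exact (hx.extend_zero i j t h).le.trans zero_le_one

theorem isClosed_posSemidef {X m : Type*} [TopologicalSpace X] [Fintype m]
    {A : X → Matrix m m ℝ} (hA : Continuous A) : IsClosed {x | (A x).PosSemidef} := by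
  simp only [Matrix.posSemidef_iff_dotProduct_mulVec, Set.ofPred_and, Set.ofPred_forall,
    Matrix.IsHermitian]
  refine IsClosed.inter (isClosed_eq (by fun_prop) hA) (isClosed_iInter fun y => ?_)
  exact isClosed_le continuous_const (by fun_prop)

theorem continuous_eval (i j t : ℕ) : Continuous fun x : ℕ → ℕ → ℕ → ℝ => x i j t := by
  fun_prop

theorem isClosed_feasible (D d : ℕ) : IsClosed {x | Feasible D d x} := by
  have e : {x | Feasible D d x} =
      {x | ∀ i j t, ¬ IsIndex D i j t → x i j t = 0} ∩ {x | x 0 0 0 = 1} ∩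
      {x | ∀ i j t, IsIndex D i j t → 0 ≤ x i j t ∧ x i j t ≤ x i 0 0} ∩
      {x | ∀ i j t i' j' t', IsIndex D i j t → IsIndex D i' j' t' → i + j - 2 * t ≤ D →
        [i', j', i' + j' - 2 * t'].Perm [i, j, i + j - 2 * t] → x i j t = x i' j' t'} ∩
      {x | ∀ i j t i' j' t', IsIndex D i j t → IsIndex D i' j' t' →
        D + 1 ≤ i + j - 2 * t → i + j - 2 * t ≤ 2 * D →
        [i', j', 2 * D + 1 - (i' + j' - 2 * t')].Perm [i, j, 2 * D + 1 - (i + j - 2 * t)] →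
        x i j t = x i' j' t'} ∩
      {x | ∀ i j t, IsIndex D i j t →
        (∃ k ∈ ({i, j, i + j - 2 * t, 2 * D + 1 - (i + j - 2 * t)} : Set ℕ), 1 ≤ k ∧ k < d) →
        x i j t = 0} ∩
      {x | ∀ r ≤ D, (blockMatrix D x r).PosSemidef} ∩
      {x | ∀ r ≤ D, (blockMatrixCompl D x r).PosSemidef} := by
    ext x
    constructor
    · rintro ⟨h1, h2, h3, h4, h5, h6, h7, h8⟩
      exact ⟨⟨⟨⟨⟨⟨⟨h1, h2⟩, h3⟩, h4⟩, h5⟩, h6⟩, h7⟩, h8⟩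
    · rintro ⟨⟨⟨⟨⟨⟨⟨h1, h2⟩, h3⟩, h4⟩, h5⟩, h6⟩, h7⟩, h8⟩
      exact ⟨h1, h2, h3, h4, h5, h6, h7, h8⟩
  rw [e]
  simp only [Set.ofPred_forall, Set.ofPred_and]
  refine (((((((IsClosed.inter ?_ ?_).inter ?_).inter ?_).inter ?_).inter ?_).inter ?_).inter ?_)
  · exact isClosed_iInter fun i => isClosed_iInter fun j => isClosed_iInter fun t =>
      isClosed_iInter fun _ => isClosed_eq (continuous_eval _ _ _) continuous_const
  · exact isClosed_eq (continuous_eval _ _ _) continuous_const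
  · exact isClosed_iInter fun i => isClosed_iInter fun j => isClosed_iInter fun t =>
      isClosed_iInter fun _ => (isClosed_le continuous_const (continuous_eval _ _ _)).inter
        (isClosed_le (continuous_eval _ _ _) (continuous_eval _ _ _))
  · exact isClosed_iInter fun i => isClosed_iInter fun j => isClosed_iInter fun t =>
      isClosed_iInter fun i' => isClosed_iInter fun j' => isClosed_iInter fun t' =>
      isClosed_iInter fun _ => isClosed_iInter fun _ => isClosed_iInter fun _ =>
      isClosed_iInter fun _ => isClosed_eq (continuous_eval _ _ _) (continuous_eval _ _ _)
  · exact isClosed_iInter fun i => isClosed_iInter fun j => isClosed_iInter fun t =>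
      isClosed_iInter fun i' => isClosed_iInter fun j' => isClosed_iInter fun t' =>
      isClosed_iInter fun _ => isClosed_iInter fun _ => isClosed_iInter fun _ =>
      isClosed_iInter fun _ => isClosed_iInter fun _ =>
      isClosed_eq (continuous_eval _ _ _) (continuous_eval _ _ _)
  · exact isClosed_iInter fun i => isClosed_iInter fun j => isClosed_iInter fun t =>
      isClosed_iInter fun _ => isClosed_iInter fun _ =>
      isClosed_eq (continuous_eval _ _ _) continuous_const
  · refine isClosed_iInter fun r => isClosed_iInter fun _ => isClosed_posSemidef ?_
    refine continuous_matrix fun i j => ?_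
    simp only [blockMatrix, Matrix.of_apply]
    fun_prop
  · refine isClosed_iInter fun r => isClosed_iInter fun _ => isClosed_posSemidef ?_
    refine continuous_matrix fun i j => ?_
    simp only [blockMatrixCompl, Matrix.of_apply]
    fun_prop

/-- In the product topology the order interval `[0, 1]` is compact, and the objective is a finite
sum of coordinates, hence continuous. -/
theorem isCompact_feasibleValues (D d : ℕ) : IsCompact (feasibleValues D d) := by
  have hc : IsCompact {x | Feasible D d x} :=
    isCompact_Icc.of_isClosed_subset (isClosed_feasible D d) fun _ hx => Feasible.mem_Icc hx
  exact hc.image (continuous_finsetSum _ fun i _ => continuous_const.mul (continuous_eval _ _ _))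

end FoldedCubeSDP

theorem mainTheorem3 (D d : ℕ) (hd : d ≤ 2 * D + 1) :
    IsGreatest (FoldedCubeSDP.feasibleValues D d) (FoldedCubeSDP.sdpOptimum D d) ∧
      (FoldedCubeSDP.maxCodeSize (FoldedCubeSDP.foldedCube (2 * D + 1)) d : ℝ) ≤
        FoldedCubeSDP.sdpOptimum D d := by
  have hmem := FoldedCubeSDP.maxCodeSize_mem_feasibleValues hd
  have h := (FoldedCubeSDP.isCompact_feasibleValues D d).isGreatest_sSup ⟨_, hmem⟩
  exact ⟨h, h.2 hmem⟩
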